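/- Let $a=(a_k)_{k\ge1}$ and $b=(b_k)_{k\ge1}$ be sequences of complex numbers with $a_1=b_1=0$. Definitions. Let $\Gamma$ be the algebra of supersymmetric functions: sequences $f=(f_n)_{n\ge 1}$ of symmetric polynomials $f_n\in\mathbb C[x_1,\dots,x_n]$ of bounded degree such that $f_{n+1}(x_1,\dots,x_n,0)=f_n(x_1,\dots,x_n)$ and such that, for all $i<j$, substituting $x_i=t$, $x_j=-t$ in $f_n$ gives a polynomial that does not depend on $t$. A strict partition is a finite sequence $\lambda=(\lambda_1>\dots>\lambda_l>0)$ of integers; $\ell(\lambda)=l$ is its length (the empty partition is allowed), and $\nu\subset\mu$ means $\nu_i\le\mu_i$ for all $i$ (missing parts being $0$; equality is allowed). Put $(x\mid a)^m=\prod_{k=1}^m(x-a_k)$. For a strict partition $\lambda$ of length $l$ the multiparameter Schur Q-function $Q_{\lambda;a}\in\Gamma$ is the sequence of the polynomials $$Q_{\lambda;a}(x_1,\dots,x_n)=\frac{2^{l}}{(n-l)!}\sum_{\omega\in S(n)}\ \prod_{i=1}^{l}(x_{\omega(i)}\mid a)^{\lambda_i}\prod_{i\le l,\ i<j\le n}\frac{x_{\omega(i)}+x_{\omega(j)}}{x_{\omega(i)}-x_{\omega(j)}}\quad(n\ge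 l),$$ and $Q_{\lambda;a}(x_1,\dots,x_n)=0$ for $n<l$. For finite families $x=(x_1,\dots,x_p)$, $y=(y_1,\dots,y_q)$ of complex numbers let $h_k(x_1,\dots,x_p;y_1,\dots,y_q)=\sum_{i=0}^k h_i(x)\,e_{k-i}(y)$ be the complete homogeneous function in the super realization, i.e. the coefficient of $t^k$ in $\prod_j(1+y_jt)/\prod_i(1-x_it)$. For $r,r'\ge 1$ put $$d_{rr'}=h_{r-r'}(b_2,\dots,b_{r'+1};-a_2,\dots,-a_r)\ \text{ if } r\ge r',\qquad d_{rr'}=0\ \text{ if } r<r'.$$ Theorem. For every strict partition $\mu$ one has in $\Gamma$ $$Q_{\mu;a}=\sum_{\nu}\det\bigl((d_{\mu_i\nu_j})_{1\le i,j\le\ell(\mu)}\bigr)\,Q_{\nu;b},$$ where the sum is over all strict partitions $\nu$ with $\ell(\nu)=\ell(\mu)$ and $\nu\subset\mu$. -/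

import Mathlib

namespace SchurQ

open MvPolynomial

/- Sequences `(a_k)_{k ≥ 1}` of complex numbers are functions `a : ℕ → ℂ`; the value `a 0`
is never used. -/

/-! ### The algebra of supersymmetric functions -/

/-- The algebra `Γ(n)` of supersymmetric polynomials in `n` variables: symmetric polynomials `f`
such that `f(…, t, …, -t, …)` (`t` and `-t` in the places `i < j`) does not depend on `t`. -/
def supersymmetricPolynomials (n : ℕ) : Subalgebra ℂ (MvPolynomial (Fin n) ℂ) where
  carrier := {f | f.IsSymmetric ∧
    ∀ i j : Fin n, i < j → ∀ (x : Fin n → ℂ) (s t : ℂ),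
      eval (Function.update (Function.update x i s) j (-s)) f =
        eval (Function.update (Function.update x i t) j (-t)) f}
  mul_mem' := by
    rintro f g ⟨hf, hf'⟩ ⟨hg, hg'⟩
    refine ⟨hf.mul hg, fun i j hij x s t => ?_⟩
    rw [map_mul, map_mul, hf' i j hij x s t, hg' i j hij x s t]
  add_mem' := by
    rintro f g ⟨hf, hf'⟩ ⟨hg, hg'⟩
    refine ⟨hf.add hg, fun i j hij x s t => ?_⟩
    rw [map_add, map_add, hf' i j hij x s t, hg' i j hij x s t]
  algebraMap_mem' r := by
    refine ⟨?_, fun i j hij x s t => ?_⟩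
    · exact IsSymmetric.C r
    · simp [algebraMap_eq]

/-- The specialization `x_{n+1} = 0`. -/
noncomputable def specializeLast (n : ℕ) :
    MvPolynomial (Fin (n + 1)) ℂ →ₐ[ℂ] MvPolynomial (Fin n) ℂ :=
  aeval (Fin.snoc (α := fun _ => MvPolynomial (Fin n) ℂ) X 0)

/-- The algebra `Γ` of supersymmetric functions: sequences `(f_n)` with `f_n ∈ Γ(n)`,
`f_{n+1}(x_1, …, x_n, 0) = f_n(x_1, …, x_n)`, and bounded degree. (The term with `n = 0`
is determined by the others.) -/
def supersymmetricFunctions : Subalgebra ℂ (∀ n : ℕ, MvPolynomial (Fin n) ℂ) where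
  carrier := {f | (∀ n, f n ∈ supersymmetricPolynomials n) ∧
    (∀ n, specializeLast n (f (n + 1)) = f n) ∧ ∃ N : ℕ, ∀ n, (f n).totalDegree ≤ N}
  mul_mem' := by
    rintro f g ⟨hf, hf', M, hM⟩ ⟨hg, hg', N, hN⟩
    refine ⟨fun n => mul_mem (hf n) (hg n), fun n => ?_, M + N, fun n => ?_⟩
    · simp [hf' n, hg' n]
    · exact (totalDegree_mul _ _).trans (add_le_add (hM n) (hN n))
  add_mem' := by
    rintro f g ⟨hf, hf', M, hM⟩ ⟨hg, hg', N, hN⟩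
    refine ⟨fun n => add_mem (hf n) (hg n), fun n => ?_, max M N, fun n => ?_⟩
    · simp [hf' n, hg' n]
    · exact (totalDegree_add _ _).trans (max_le_max (hM n) (hN n))
  algebraMap_mem' r := by
    refine ⟨fun n => (supersymmetricPolynomials n).algebraMap_mem r, fun n => ?_, 0, fun n => ?_⟩
    · simp only [Pi.algebraMap_apply]
      exact AlgHom.commutes _ r
    · simp only [Pi.algebraMap_apply, algebraMap_eq]
      simp

/-! ### Strict partitions -/

/-- A strict partition, given by the list `λ_1 > λ_2 > … > λ_l > 0` of its non-zero parts. -/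
@[ext]
structure StrictPartition where
  parts : List ℕ
  decreasing : parts.Pairwise (fun p q => p > q)
  positive : ∀ p ∈ parts, 0 < p

namespace StrictPartition

/-- The number `ℓ(λ)` of non-zero parts. -/
def length (lam : StrictPartition) : ℕ := lam.parts.length

/-- `lam.part i` is `λ_{i+1}` (indices start at `0` here); it is `0` for `i ≥ ℓ(λ)`. -/
def part (lam : StrictPartition) (i : ℕ) : ℕ := lam.parts.getD i 0

/-- Containment `ν ⊂ μ` of (diagrams of) partitions; equality is allowed. -/
def Contained (nu mu : StrictPartition) : Prop := ∀ i, nu.part i ≤ mu.part i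

theorem part_pos (lam : StrictPartition) {i : ℕ} (hi : i < lam.length) : 0 < lam.part i := by
  unfold part
  unfold length at hi
  rw [List.getD_eq_getElem _ _ hi]
  exact lam.positive _ (List.getElem_mem hi)

theorem finite_contained (mu : StrictPartition) :
    {nu : StrictPartition | nu.length = mu.length ∧ nu.Contained mu}.Finite := by
  have hfin : (Set.pi Set.univ
      (fun i : Fin mu.length => Set.Iic (mu.part i)) : Set (Fin mu.length → ℕ)).Finite :=
    Set.Finite.pi' (fun i => Set.finite_Iic _) |>.subset (fun f hf i => hf i trivial)
  refine Set.Finite.of_finite_image (f := fun nu (i : Fin mu.length) => nu.part i)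
    (hfin.subset ?_) ?_
  · rintro _ ⟨nu, hnu, rfl⟩ i _
    exact hnu.2 i
  · intro nu hnu rho hrho h
    ext1
    refine List.ext_getElem (hnu.1.trans hrho.1.symm) fun i h1 h2 => ?_
    have := congrFun h ⟨i, hnu.1 ▸ h1⟩
    simp only [part] at this
    rwa [List.getD_eq_getElem _ _ h1, List.getD_eq_getElem _ _ h2] at this

/-- The finite set of strict partitions `ν` with `ℓ(ν) = ℓ(μ)` and `ν ⊂ μ`. -/
noncomputable def containedSameLength (mu : StrictPartition) : Finset StrictPartition :=
  mu.finite_contained.toFinset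

end StrictPartition

/-! ### Multiparameter Schur functions -/

section Rational

variable {F : Type*} [Field F] [Algebra ℂ F]

/-- The generalized power `(x | a)^m = (x - a_1) ⋯ (x - a_m)`. -/
def genPow (a : ℕ → ℂ) (x : F) (m : ℕ) : F :=
  ∏ k ∈ Finset.Icc 1 m, (x - algebraMap ℂ F (a k))

/-- `∏_{i ≤ l} (x_i | a)^{λ_i} ∏_{i ≤ l, i < j ≤ n} (x_i + x_j) / (x_i - x_j)`, `l = ℓ(λ)`. -/
def summand (a : ℕ → ℂ) (lam : StrictPartition) {n : ℕ} (x : Fin n → F) : F :=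
  (∏ i : Fin n with (i : Fin n).val < lam.length, genPow a (x i) (lam.part i)) *
    ∏ i : Fin n with (i : Fin n).val < lam.length, ∏ j : Fin n with i < j, (x i + x j) / (x i - x j)

/-- The value of `P_{λ;a|n} = 1 / (n - l)! ∑_{w ∈ S(n)} summand (x_{w(1)}, …, x_{w(n)})`
(and `P_{λ;a|n} = 0` if `l = ℓ(λ) > n`) at a point with distinct coordinates in an extension field
of `ℂ`. -/
noncomputable def multiPValue (a : ℕ → ℂ) (lam : StrictPartition) {n : ℕ} (x : Fin n → F) : F :=
  if lam.length ≤ n then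
    ((n - lam.length).factorial : F)⁻¹ * ∑ w : Equiv.Perm (Fin n), summand a lam (x ∘ w)
  else 0

end Rational

/-- The variables `x_1, …, x_n` as elements of the field `ℂ(x_1, …, x_n)`. -/
noncomputable def ratVar (n : ℕ) (i : Fin n) : FractionRing (MvPolynomial (Fin n) ℂ) :=
  algebraMap (MvPolynomial (Fin n) ℂ) _ (X i)

/-- `P_{λ;a|n}(x_1, …, x_n)` as a rational function. -/
noncomputable def multiPRat (a : ℕ → ℂ) (lam : StrictPartition) (n : ℕ) :
    FractionRing (MvPolynomial (Fin n) ℂ) :=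
  multiPValue a lam (ratVar n)

/-! ### The rational functions above are polynomials and define an element of `Γ` -/

section Polynomiality

variable {n : ℕ}

theorem ratVar_injective (n : ℕ) : Function.Injective (ratVar n) := by
  intro i j h
  exact X_injective (IsFractionRing.injective (MvPolynomial (Fin n) ℂ) _ h)

theorem aeval_ratVar (p : MvPolynomial (Fin n) ℂ) :
    aeval (ratVar n) p = algebraMap _ (FractionRing (MvPolynomial (Fin n) ℂ)) p := by
  have : aeval (ratVar n) = (IsScalarTower.toAlgHom ℂ (MvPolynomial (Fin n) ℂ)
      (FractionRing (MvPolynomial (Fin n) ℂ))) := by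
    ext i
    simp [ratVar]
  rw [this]
  rfl

/-- Substitution of `x_j` for `x_i`. -/
noncomputable def subst (i j : Fin n) : MvPolynomial (Fin n) ℂ →ₐ[ℂ] MvPolynomial (Fin n) ℂ :=
  aeval (Function.update X i (X j))

theorem sub_dvd_iff {i j : Fin n} (p : MvPolynomial (Fin n) ℂ) :
    X i - X j ∣ p ↔ subst i j p = 0 := by
  constructor
  · rintro ⟨q, rfl⟩
    by_cases h : i = j
    · simp [subst, h]
    · simp [subst, Function.update_of_ne (Ne.symm h)]
  · intro h
    let I := Ideal.span {(X i - X j : MvPolynomial (Fin n) ℂ)}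
    have key : (Ideal.Quotient.mkₐ ℂ I).comp (subst i j) = Ideal.Quotient.mkₐ ℂ I := by
      ext k
      by_cases hk : k = i
      · subst hk
        simp only [subst, AlgHom.comp_apply, aeval_X, Function.update_self]
        symm
        exact Ideal.Quotient.eq.2 (Ideal.subset_span rfl)
      · simp [subst, hk]
    have h2 := DFunLike.congr_fun key p
    rw [AlgHom.comp_apply, h, map_zero] at h2
    exact Ideal.mem_span_singleton.1 (Ideal.Quotient.eq_zero_iff_mem.1 h2.symm)

theorem sub_prime {i j : Fin n} (hij : i ≠ j) : Prime (X i - X j : MvPolynomial (Fin n) ℂ) := by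
  refine ⟨sub_ne_zero.2 fun h => hij (X_injective h), fun h => ?_, fun p q h => ?_⟩
  · have := (sub_dvd_iff (i := i) (j := j) 1).1 (isUnit_iff_dvd_one.1 h)
    simp at this
  · rw [sub_dvd_iff, map_mul, mul_eq_zero] at h
    simpa only [sub_dvd_iff] using h

/-- The Vandermonde product `∏_{i<j} (x_i - x_j)`. -/
noncomputable def vdm (n : ℕ) : MvPolynomial (Fin n) ℂ :=
  ∏ i : Fin n, ∏ j : Fin n with i < j, (X i - X j)

/-- A polynomial that is `summand` times the Vandermonde product. -/
noncomputable def summandNum (a : ℕ → ℂ) (lam : StrictPartition) (n : ℕ) :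
    MvPolynomial (Fin n) ℂ :=
  (∏ i : Fin n with (i : Fin n).val < lam.length, ∏ k ∈ Finset.Icc 1 (lam.part i), (X i - C (a k))) *
    ∏ i : Fin n, ∏ j : Fin n with i < j, if (i : ℕ) < lam.length then X i + X j else X i - X j

/-- The antisymmetrization of `summandNum`. -/
noncomputable def numer (a : ℕ → ℂ) (lam : StrictPartition) (n : ℕ) : MvPolynomial (Fin n) ℂ :=
  if lam.length ≤ n then
    C ((n - lam.length).factorial : ℂ)⁻¹ *
      ∑ w : Equiv.Perm (Fin n), C ((Equiv.Perm.sign w : ℤ) : ℂ) * rename w (summandNum a lam n)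
  else 0

theorem vdm_dvd_of_subst (p : MvPolynomial (Fin n) ℂ)
    (hp : ∀ i j : Fin n, i < j → subst i j p = 0) : vdm n ∣ p := by
  unfold vdm
  rw [Finset.prod_sigma']
  apply Finset.prod_dvd_of_isRelPrime
  · rintro ⟨i, j⟩ hij ⟨k, l⟩ hkl hne
    simp only [Finset.coe_sigma, Set.mem_sigma_iff, Finset.coe_filter,
      Finset.mem_univ, true_and, Set.mem_ofPred_eq, Finset.coe_univ, Set.mem_univ] at hij hkl
    refine ((sub_prime hij.ne).irreducible.isRelPrime_iff_not_dvd).2 ?_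
    rw [sub_dvd_iff]
    simp only [subst, map_sub, aeval_X, sub_eq_zero, Function.update_apply]
    intro h
    apply hne
    split_ifs at h with h1 h2 h2
    · omega
    · have := X_injective h
      subst this; subst h1; rfl
    · have := X_injective h
      omega
    · have := X_injective h
      omega
  · rintro ⟨i, j⟩ hij
    simp only [Finset.mem_sigma, Finset.mem_filter, Finset.mem_univ, true_and] at hij
    exact (sub_dvd_iff p).2 (hp i j hij)

theorem rename_numer (a : ℕ → ℂ) (lam : StrictPartition) (v : Equiv.Perm (Fin n)) :
    rename v (numer a lam n) = C ((Equiv.Perm.sign v : ℤ) : ℂ) * numer a lam n := by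
  unfold numer
  split_ifs
  · simp only [map_mul, map_sum, rename_C, rename_rename]
    rw [mul_left_comm]
    congr 1
    rw [Finset.mul_sum]
    refine Fintype.sum_equiv (Equiv.mulLeft v) _ _ fun w => ?_
    have h1 : ((Equiv.Perm.sign v : ℤ) : ℂ) * ((Equiv.Perm.sign v : ℤ) : ℂ) = 1 := by
      rw [← Int.cast_mul, ← Units.val_mul, Int.units_mul_self]; simp
    simp only [Equiv.coe_mulLeft, Equiv.Perm.coe_mul, map_mul, Units.val_mul, Int.cast_mul]
    rw [← mul_assoc, ← mul_assoc, ← map_mul C, h1, map_one, one_mul]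
  · simp

theorem vdm_dvd_numer (a : ℕ → ℂ) (lam : StrictPartition) (n : ℕ) : vdm n ∣ numer a lam n := by
  refine vdm_dvd_of_subst _ fun i j hij => ?_
  have h := congrArg (subst i j) (rename_numer a lam (Equiv.swap i j))
  have h2 : subst i j (rename (Equiv.swap i j) (numer a lam n)) = subst i j (numer a lam n) := by
    unfold subst
    rw [aeval_rename]
    congr 2
    funext k
    simp only [Function.comp_apply, Function.update_apply, Equiv.swap_apply_def]
    split_ifs <;> simp_all
  rw [h2, Equiv.Perm.sign_swap hij.ne] at h
  simp only [Units.val_neg, Units.val_one, Int.cast_neg, Int.cast_one, map_neg, map_one,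
    neg_mul, one_mul] at h
  exact self_eq_neg.1 h

section Field

variable {F : Type*} [Field F] [Algebra ℂ F]

theorem aeval_vdm (x : Fin n → F) :
    aeval x (vdm n) = ∏ i : Fin n, ∏ j : Fin n with i < j, (x i - x j) := by
  simp [vdm]

theorem aeval_vdm_ne_zero {x : Fin n → F} (hx : Function.Injective x) : aeval x (vdm n) ≠ 0 := by
  rw [aeval_vdm]
  refine Finset.prod_ne_zero_iff.2 fun i _ => Finset.prod_ne_zero_iff.2 fun j hj => ?_
  simp only [Finset.mem_filter, Finset.mem_univ, true_and] at hj
  exact sub_ne_zero.2 fun h => hj.ne (hx h)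

theorem aeval_vdm_comp (x : Fin n → F) (w : Equiv.Perm (Fin n)) :
    aeval (x ∘ w) (vdm n) = ((Equiv.Perm.sign w : ℤ) : F) * aeval x (vdm n) := by
  have key : ∀ y : Fin n → F, aeval y (vdm n) = (Matrix.vandermonde (fun i => - y i)).det := by
    intro y
    rw [aeval_vdm, Matrix.det_vandermonde]
    refine Finset.prod_congr rfl fun i _ => Finset.prod_congr ?_ fun j _ => by ring
    ext j; simp
  rw [key, key, ← Matrix.det_permute]
  rfl

theorem aeval_summandNum (a : ℕ → ℂ) (lam : StrictPartition) {x : Fin n → F}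
    (hx : Function.Injective x) :
    aeval x (summandNum a lam n) = summand a lam x * aeval x (vdm n) := by
  rw [aeval_vdm, summandNum, summand, map_mul, mul_assoc]
  congr 1
  · simp [genPow]
  · simp only [map_prod]
    rw [Finset.prod_filter, ← Finset.prod_mul_distrib]
    refine Finset.prod_congr rfl fun i _ => ?_
    split_ifs with hi
    · rw [← Finset.prod_mul_distrib]
      refine Finset.prod_congr rfl fun j hj => ?_
      simp only [Finset.mem_filter, Finset.mem_univ, true_and] at hj
      have : x i - x j ≠ 0 := sub_ne_zero.2 fun h => hj.ne (hx h)
      simp only [map_add, aeval_X]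
      field_simp
    · simp

theorem aeval_numer (a : ℕ → ℂ) (lam : StrictPartition) {x : Fin n → F}
    (hx : Function.Injective x) :
    aeval x (numer a lam n) = multiPValue a lam x * aeval x (vdm n) := by
  unfold numer multiPValue
  split_ifs
  · simp only [map_mul, map_sum, aeval_rename, aeval_C, map_inv₀, map_natCast, map_intCast]
    rw [mul_assoc, Finset.sum_mul]
    congr 1
    refine Finset.sum_congr rfl fun w _ => ?_
    rw [aeval_summandNum a lam (hx.comp w.injective), aeval_vdm_comp]
    have h1 : ((Equiv.Perm.sign w : ℤ) : F) * ((Equiv.Perm.sign w : ℤ) : F) = 1 := by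
      rw [← Int.cast_mul, ← Units.val_mul, Int.units_mul_self]; simp
    linear_combination (summand a lam (x ∘ w) * aeval x (vdm n)) * h1
  · simp

theorem multiPValue_comp_perm (a : ℕ → ℂ) (lam : StrictPartition) (x : Fin n → F)
    (v : Equiv.Perm (Fin n)) : multiPValue a lam (x ∘ v) = multiPValue a lam x := by
  unfold multiPValue
  split_ifs
  · congr 1
    exact Fintype.sum_equiv (Equiv.mulLeft v) _ _ fun w => rfl
  · rfl

end Field

/-- The rational function `P_{λ;a|n}` is a polynomial. -/
theorem exists_multiPPoly (a : ℕ → ℂ) (lam : StrictPartition) (n : ℕ) :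
    ∃ p : MvPolynomial (Fin n) ℂ, algebraMap _ _ p = multiPRat a lam n := by
  obtain ⟨p, hp⟩ := vdm_dvd_numer a lam n
  refine ⟨p, ?_⟩
  have h := aeval_numer a lam (ratVar_injective n)
  rw [hp, map_mul, mul_comm] at h
  rw [← aeval_ratVar]
  exact mul_right_cancel₀ (aeval_vdm_ne_zero (ratVar_injective n)) h

end Polynomiality

/-- `P_{λ;a|n}(x_1, …, x_n)` as a polynomial. -/
noncomputable def multiPPoly (a : ℕ → ℂ) (lam : StrictPartition) (n : ℕ) :
    MvPolynomial (Fin n) ℂ :=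
  (exists_multiPPoly a lam n).choose

theorem algebraMap_multiPPoly (a : ℕ → ℂ) (lam : StrictPartition) (n : ℕ) :
    algebraMap _ _ (multiPPoly a lam n) = multiPRat a lam n :=
  (exists_multiPPoly a lam n).choose_spec

section Membership

variable {n : ℕ}

theorem vdm_mul_multiPPoly (a : ℕ → ℂ) (lam : StrictPartition) (n : ℕ) :
    multiPPoly a lam n * vdm n = numer a lam n := by
  apply IsFractionRing.injective (MvPolynomial (Fin n) ℂ) (FractionRing (MvPolynomial (Fin n) ℂ))
  rw [← aeval_ratVar (numer a lam n), aeval_numer a lam (ratVar_injective n), map_mul,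
    algebraMap_multiPPoly, aeval_ratVar]
  rfl

theorem aeval_multiPPoly {F : Type*} [Field F] [Algebra ℂ F] (a : ℕ → ℂ) (lam : StrictPartition)
    {x : Fin n → F} (hx : Function.Injective x) :
    aeval x (multiPPoly a lam n) = multiPValue a lam x := by
  have h := aeval_numer a lam hx
  rw [← vdm_mul_multiPPoly, map_mul] at h
  exact mul_right_cancel₀ (aeval_vdm_ne_zero hx) h

theorem multiPPoly_isSymmetric (a : ℕ → ℂ) (lam : StrictPartition) (n : ℕ) :
    (multiPPoly a lam n).IsSymmetric := by
  intro v
  apply IsFractionRing.injective (MvPolynomial (Fin n) ℂ) (FractionRing (MvPolynomial (Fin n) ℂ))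
  rw [← aeval_ratVar, ← aeval_ratVar, aeval_rename,
    aeval_multiPPoly a lam ((ratVar_injective n).comp v.injective),
    aeval_multiPPoly a lam (ratVar_injective n), multiPValue_comp_perm]

/-- If `x_i + x_j = 0` then `summand` does not depend on `x_i`. -/
theorem summand_eq {F : Type*} [Field F] [Algebra ℂ F] (a : ℕ → ℂ) (lam : StrictPartition)
    {x y : Fin n → F} (hx : Function.Injective x) (hy : Function.Injective y) {i j : Fin n}
    (hij : i < j) (h : ∀ k, k ≠ i → k ≠ j → x k = y k) (hxx : x j = - x i) (hyy : y j = - y i) :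
    summand a lam x = summand a lam y := by
  by_cases hi : (i : ℕ) < lam.length
  · have zero : ∀ z : Fin n → F, z j = - z i → summand a lam z = 0 := by
      intro z hz
      unfold summand
      rw [Finset.prod_eq_zero (i := i) (s := Finset.univ.filter
          (fun i : Fin n => (i : ℕ) < lam.length)) (by simpa using hi) (f := fun i =>
          ∏ j : Fin n with i < j, (z i + z j) / (z i - z j)), mul_zero]
      exact Finset.prod_eq_zero (i := j) (by simpa using hij) (by simp [hz])
    rw [zero x hxx, zero y hyy]
  · unfold summand
    have ne : ∀ k : Fin n, (k : ℕ) < lam.length → k < i ∧ k < j := by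
      intro k hk
      have : k < i := by
        rw [Fin.lt_def]; omega
      exact ⟨this, this.trans hij⟩
    congr 1
    · refine Finset.prod_congr rfl fun k hk => ?_
      simp only [Finset.mem_filter, Finset.mem_univ, true_and] at hk
      rw [h k (ne k hk).1.ne (ne k hk).2.ne]
    · refine Finset.prod_congr rfl fun k hk => ?_
      simp only [Finset.mem_filter, Finset.mem_univ, true_and] at hk
      obtain ⟨hki, hkj⟩ := ne k hk
      have split : ∀ z : Fin n → F, Function.Injective z → z j = - z i →
          ∏ m : Fin n with k < m, (z k + z m) / (z k - z m) =
            ∏ m ∈ ((Finset.univ.filter (fun m : Fin n => k < m)).erase i).erase j,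
              (z k + z m) / (z k - z m) := by
        intro z hz hzz
        rw [← Finset.mul_prod_erase _ _ (a := i) (by simpa using hki),
          ← Finset.mul_prod_erase _ _ (a := j)
            (by simpa [hij.ne'] using hkj), ← mul_assoc]
        have h1 : z k - z i ≠ 0 := sub_ne_zero.2 fun h => hki.ne (hz h)
        have h2 : z k - z j ≠ 0 := sub_ne_zero.2 fun h => hkj.ne (hz h)
        rw [hzz] at h2 ⊢
        have h3 : z k + z i ≠ 0 := by simpa using h2
        have : (z k + z i) / (z k - z i) * ((z k + -z i) / (z k - -z i)) = 1 := by
          rw [sub_neg_eq_add, ← sub_eq_add_neg]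
          field_simp
        rw [this, one_mul]
      rw [split x hx hxx, split y hy hyy]
      refine Finset.prod_congr rfl fun m hm => ?_
      simp only [Finset.mem_erase] at hm
      rw [h k hki.ne hkj.ne, h m hm.2.1 hm.1]

theorem multiPValue_eq {F : Type*} [Field F] [Algebra ℂ F] (a : ℕ → ℂ) (lam : StrictPartition)
    {x y : Fin n → F} (hx : Function.Injective x) (hy : Function.Injective y) {i j : Fin n}
    (hij : i ≠ j) (h : ∀ k, k ≠ i → k ≠ j → x k = y k) (hxx : x j = - x i) (hyy : y j = - y i) :
    multiPValue a lam x = multiPValue a lam y := by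
  unfold multiPValue
  split_ifs
  · congr 1
    refine Finset.sum_congr rfl fun w _ => ?_
    have hx' := hx.comp w.injective
    have hy' := hy.comp w.injective
    have h' : ∀ k, k ≠ w.symm i → k ≠ w.symm j → (x ∘ w) k = (y ∘ w) k := by
      intro k h1 h2
      refine h _ (fun e => h1 ?_) (fun e => h2 ?_) <;> simp [← e]
    rcases lt_or_gt_of_ne (fun e => hij (w.symm.injective e) : w.symm i ≠ w.symm j) with hlt | hlt
    · exact summand_eq a lam hx' hy' hlt h' (by simpa using hxx) (by simpa using hyy)
    · exact summand_eq a lam hx' hy' hlt (fun k h1 h2 => h' k h2 h1)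
        (by simp [hxx]) (by simp [hyy])
  · rfl

theorem multiPPoly_mem (a : ℕ → ℂ) (lam : StrictPartition) (n : ℕ) :
    multiPPoly a lam n ∈ supersymmetricPolynomials n := by
  refine ⟨multiPPoly_isSymmetric a lam n, fun i j hij x s t => ?_⟩
  set p := multiPPoly a lam n
  let u : Fin n → MvPolynomial (Fin n) ℂ := Function.update X j (- X i)
  let v : Fin n → MvPolynomial (Fin n) ℂ := Function.update (Function.update X i (X j)) j (- X j)
  have hne : ∀ c d : Fin n, (X c : MvPolynomial (Fin n) ℂ) ≠ - X d := by
    intro c d h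
    have := congrArg (eval (fun _ => (1 : ℂ))) h
    norm_num at this
  have hu : Function.Injective u := by
    intro c d h
    simp only [u, Function.update_apply] at h
    split_ifs at h with h1 h2 h2
    · rw [h1, h2]
    · exact absurd h.symm (hne _ _)
    · exact absurd h (hne _ _)
    · exact X_injective h
  have hv : Function.Injective v := by
    intro c d h
    simp only [v, Function.update_apply] at h
    split_ifs at h with h1 h2 h3 h2 h3 h4 h4 h5
    all_goals first
      | (subst_vars; rfl)
      | exact absurd h (hne _ _)
      | exact absurd h.symm (hne _ _)
      | (have := X_injective h; simp_all)
  have key : aeval u p = aeval v p := by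
    apply IsFractionRing.injective (MvPolynomial (Fin n) ℂ)
      (FractionRing (MvPolynomial (Fin n) ℂ))
    have inj := IsFractionRing.injective (MvPolynomial (Fin n) ℂ)
      (FractionRing (MvPolynomial (Fin n) ℂ))
    rw [← aeval_algebraMap_apply, ← aeval_algebraMap_apply]
    have e1 := aeval_multiPPoly (F := FractionRing (MvPolynomial (Fin n) ℂ)) a lam (inj.comp hu)
    have e2 := aeval_multiPPoly (F := FractionRing (MvPolynomial (Fin n) ℂ)) a lam (inj.comp hv)
    refine e1.trans (Eq.trans ?_ e2.symm)
    refine multiPValue_eq a lam (inj.comp hu) (inj.comp hv) hij.ne ?_ ?_ ?_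
    · intro k h1 h2
      simp [u, v, h1, h2]
    · simp [u, hij.ne]
    · simp [v, hij.ne]
  have h := congrArg (eval (Function.update (Function.update x i s) j t)) key
  have hcomp : ∀ z : Fin n → MvPolynomial (Fin n) ℂ, ∀ y : Fin n → ℂ,
      eval y (aeval z p) = eval (fun k => eval y (z k)) p := by
    intro z y
    have : (aeval y : _ →ₐ[ℂ] ℂ) (aeval z p) = aeval (fun k => aeval y (z k)) p := by
      rw [← AlgHom.comp_apply, comp_aeval]
    exact this
  rw [hcomp, hcomp] at h
  convert h using 3 with k k
  · funext k
    simp only [u, Function.update_apply]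
    split_ifs <;> simp_all [Function.update_of_ne hij.ne]
  · funext k
    simp only [v, Function.update_apply]
    split_ifs <;> simp_all

theorem multiPPoly_totalDegree_le (a : ℕ → ℂ) (lam : StrictPartition) (n : ℕ) :
    (multiPPoly a lam n).totalDegree ≤ ∑ i ∈ Finset.range lam.length, lam.part i := by
  by_cases h0 : multiPPoly a lam n = 0
  · simp [h0]
  have hv0 : vdm n ≠ 0 := by
    intro h
    have := aeval_vdm_ne_zero (ratVar_injective n)
    simp [h] at this
  have hdeg := totalDegree_mul_of_isDomain h0 hv0
  rw [vdm_mul_multiPPoly] at hdeg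
  let D : ℕ := ∑ i : Fin n, ∑ j : Fin n with i < j, 1
  have hv : (vdm n).totalDegree = D := by
    have hom : (vdm n).IsHomogeneous D := by
      refine IsHomogeneous.prod _ _ _ fun i _ => IsHomogeneous.prod _ _ _ fun j _ => ?_
      exact (isHomogeneous_X ℂ i).sub (isHomogeneous_X ℂ j)
    exact hom.totalDegree hv0
  have hXX : ∀ i : Fin n, (X i : MvPolynomial (Fin n) ℂ).totalDegree ≤ 1 := fun i => by simp
  have hs : (summandNum a lam n).totalDegree ≤ (∑ i ∈ Finset.range lam.length, lam.part i) + D := by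
    refine (totalDegree_mul _ _).trans (add_le_add ?_ ?_)
    · refine (totalDegree_finsetProd _ _).trans ?_
      calc _ ≤ ∑ i : Fin n with (i : Fin n).val < lam.length, lam.part i := by
            refine Finset.sum_le_sum fun i _ => (totalDegree_finsetProd _ _).trans ?_
            calc _ ≤ ∑ k ∈ Finset.Icc 1 (lam.part i), 1 := by
                  refine Finset.sum_le_sum fun k _ => (totalDegree_sub _ _).trans ?_
                  simp
              _ = _ := by simp
        _ = ∑ i ∈ (Finset.univ.filter (fun i : Fin n => (i : ℕ) < lam.length)).map
              Fin.valEmbedding, lam.part i := by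
            rw [Finset.sum_map]; rfl
        _ ≤ _ := by
            refine Finset.sum_le_sum_of_subset ?_
            intro k hk
            simp only [Finset.mem_map, Finset.mem_filter, Finset.mem_univ, true_and] at hk
            obtain ⟨i, hi, rfl⟩ := hk
            simpa using hi
    · refine (totalDegree_finsetProd _ _).trans (Finset.sum_le_sum fun i _ => ?_)
      refine (totalDegree_finsetProd _ _).trans (Finset.sum_le_sum fun j _ => ?_)
      split_ifs
      · exact (totalDegree_add _ _).trans (max_le (hXX _) (hXX _))
      · exact (totalDegree_sub _ _).trans (max_le (hXX _) (hXX _))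
  have hn : (numer a lam n).totalDegree ≤ (∑ i ∈ Finset.range lam.length, lam.part i) + D := by
    unfold numer
    split_ifs
    · refine (totalDegree_mul _ _).trans ?_
      rw [totalDegree_C, zero_add]
      refine totalDegree_finsetSum_le fun w _ => ?_
      refine (totalDegree_mul _ _).trans ?_
      rw [totalDegree_C, zero_add]
      exact (totalDegree_rename_le _ _).trans hs
    · simp
  omega

/-- The summand is unchanged under permutations of the last `n - ℓ(λ)` variables. -/
theorem summand_comp_swap {F : Type*} [Field F] [Algebra ℂ F] (a : ℕ → ℂ) (lam : StrictPartition)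
    (x : Fin n → F) (v : Equiv.Perm (Fin n)) (hv : ∀ i : Fin n, (i : ℕ) < lam.length → v i = i) :
    summand a lam (x ∘ v) = summand a lam x := by
  have hge : ∀ i : Fin n, lam.length ≤ (i : ℕ) → lam.length ≤ (v i : ℕ) := by
    intro i hi
    by_contra hlt
    have := v.injective (hv _ (not_le.1 hlt))
    rw [this] at hlt
    exact hlt hi
  have hge' : ∀ i : Fin n, lam.length ≤ (v i : ℕ) → lam.length ≤ (i : ℕ) := by
    intro i hi
    by_contra hlt
    rw [hv _ (not_le.1 hlt)] at hi
    exact hlt hi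
  unfold summand
  congr 1
  · refine Finset.prod_congr rfl fun i hi => ?_
    simp only [Finset.mem_filter, Finset.mem_univ, true_and] at hi
    simp [hv i hi]
  · refine Finset.prod_congr rfl fun i hi => ?_
    simp only [Finset.mem_filter, Finset.mem_univ, true_and] at hi
    simp only [Function.comp_apply, hv i hi]
    refine Finset.prod_equiv v (fun j => ?_) (fun j _ => rfl)
    simp only [Finset.mem_filter, Finset.mem_univ, true_and]
    by_cases hj : (j : ℕ) < lam.length
    · rw [hv j hj]
    · have h1 := hge j (not_lt.1 hj)
      simp only [Fin.lt_def]
      omega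

theorem summand_snoc {F : Type*} [Field F] [Algebra ℂ F] (a : ℕ → ℂ) (lam : StrictPartition)
    (x : Fin n → F) (hx : ∀ i, x i ≠ 0) (hl : lam.length ≤ n) :
    summand a lam (Fin.snoc (α := fun _ => F) x 0) = summand a lam x := by
  unfold summand
  simp only [Finset.prod_filter]
  rw [Fin.prod_univ_castSucc, Fin.prod_univ_castSucc (n := n)]
  simp only [Fin.val_castSucc, Fin.snoc_castSucc, Fin.val_last, Nat.not_lt.2 hl, if_false, mul_one]
  congr 1
  refine Finset.prod_congr rfl fun i _ => ?_
  rw [Fin.prod_univ_castSucc]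
  simp [Fin.castSucc_lt_last, hx i]

theorem genPow_zero {F : Type*} [Field F] [Algebra ℂ F] {a : ℕ → ℂ} (ha : a 1 = 0) {m : ℕ}
    (hm : 0 < m) : genPow a (0 : F) m = 0 :=
  Finset.prod_eq_zero (i := 1) (Finset.mem_Icc.2 ⟨le_rfl, hm⟩) (by simp [ha])

theorem summand_eq_zero {F : Type*} [Field F] [Algebra ℂ F] {a : ℕ → ℂ} (ha : a 1 = 0)
    (lam : StrictPartition) (x : Fin n → F) (i : Fin n) (hi : (i : ℕ) < lam.length)
    (hx : x i = 0) : summand a lam x = 0 := by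
  unfold summand
  rw [Finset.prod_eq_zero (i := i) (s := Finset.univ.filter
    (fun i : Fin n => (i : ℕ) < lam.length)) (by simpa using hi)
    (f := fun i => genPow a (x i) (lam.part i)), zero_mul]
  rw [hx, genPow_zero ha (lam.part_pos hi)]

/-- Permutations of `n + 1` letters as pairs (position of the last letter, permutation of the
others). -/
def permEquiv (n : ℕ) : Equiv.Perm (Fin (n + 1)) ≃ Fin (n + 1) × Equiv.Perm (Fin n) :=
  (Equiv.inv _).trans <| finSuccEquivLast.permCongr.trans <| Equiv.Perm.decomposeOption.trans <|
    finSuccEquivLast.symm.prodCongr (Equiv.inv _)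

/-- The permutation of `n + 1` letters that fixes the last letter. -/
def extendPerm (s : Equiv.Perm (Fin n)) : Equiv.Perm (Fin (n + 1)) :=
  finSuccEquivLast.symm.permCongr (Equiv.optionCongr s)

theorem permEquiv_symm (m : Fin (n + 1)) (s : Equiv.Perm (Fin n)) :
    (permEquiv n).symm (m, s) = extendPerm s * Equiv.swap (Fin.last n) m := by
  have : (permEquiv n).symm (m, s) = (finSuccEquivLast.symm.permCongr
      (Equiv.swap none (finSuccEquivLast m) * Equiv.optionCongr s⁻¹))⁻¹ := by
    rfl
  rw [this]
  rw [inv_eq_iff_eq_inv, mul_inv_rev, Equiv.swap_inv]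
  ext k
  congr 1
  have hsw : ∀ o : Option (Fin n), finSuccEquivLast.symm (Equiv.swap none (finSuccEquivLast m) o) =
      Equiv.swap (Fin.last n) m (finSuccEquivLast.symm o) := by
    intro o
    rw [(finSuccEquivLast (n := n)).symm.injective.map_swap]
    simp
  simp only [Equiv.permCongr_apply, Equiv.Perm.coe_mul, Function.comp_apply, hsw]
  rfl

theorem snoc_comp_extendPerm {F : Type*} [Field F] (x : Fin n → F) (s : Equiv.Perm (Fin n)) :
    (Fin.snoc (α := fun _ => F) x 0 : Fin (n + 1) → F) ∘ extendPerm s =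
      Fin.snoc (α := fun _ => F) (x ∘ s) 0 := by
  funext k
  refine Fin.lastCases ?_ (fun k => ?_) k
  · simp [extendPerm, Equiv.permCongr_apply]
  · simp [extendPerm, Equiv.permCongr_apply]

theorem multiPValue_snoc {F : Type*} [Field F] [Algebra ℂ F] {a : ℕ → ℂ} (ha : a 1 = 0)
    (lam : StrictPartition) (x : Fin n → F) (hx : ∀ i, x i ≠ 0) :
    multiPValue a lam (Fin.snoc (α := fun _ => F) x 0) = multiPValue a lam x := by
  have hchar : CharZero F :=
    charZero_of_injective_algebraMap (algebraMap ℂ F).injective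
  set y : Fin (n + 1) → F := Fin.snoc (α := fun _ => F) x 0 with hy
  have hlast : y (Fin.last n) = 0 := by simp [hy]
  unfold multiPValue
  by_cases h1 : lam.length ≤ n
  · rw [if_pos h1, if_pos (h1.trans (Nat.le_succ n))]
    have hsum : ∑ w : Equiv.Perm (Fin (n + 1)), summand a lam (y ∘ w) =
        ((n + 1 - lam.length : ℕ) : F) * ∑ w : Equiv.Perm (Fin n), summand a lam (x ∘ w) := by
      rw [← (permEquiv n).symm.sum_comp, Fintype.sum_prod_type]
      have hterm : ∀ m : Fin (n + 1), ∑ s : Equiv.Perm (Fin n),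
          summand a lam (y ∘ ((permEquiv n).symm (m, s))) =
          if lam.length ≤ (m : ℕ) then ∑ w : Equiv.Perm (Fin n), summand a lam (x ∘ w) else 0 := by
        intro m
        split_ifs with hm
        · refine Finset.sum_congr rfl fun s _ => ?_
          rw [permEquiv_symm, Equiv.Perm.coe_mul, ← Function.comp_assoc, hy,
            snoc_comp_extendPerm, summand_comp_swap, summand_snoc a lam (x ∘ s) (fun i => hx _) h1]
          intro i hi
          apply Equiv.swap_apply_of_ne_of_ne
          · rintro rfl
            simp at hi
            omega
          · rintro rfl
            omega
        · refine Finset.sum_eq_zero fun s _ => ?_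
          refine summand_eq_zero ha lam _ m (not_le.1 hm) ?_
          rw [permEquiv_symm, Equiv.Perm.coe_mul, ← Function.comp_assoc, hy, snoc_comp_extendPerm]
          simp
      rw [Finset.sum_congr rfl fun m _ => hterm m, ← Finset.sum_filter, Finset.sum_const,
        nsmul_eq_mul]
      congr 2
      have : (Finset.univ.filter fun m : Fin (n + 1) => lam.length ≤ (m : ℕ)) =
          Finset.Ici ⟨lam.length, by omega⟩ := by
        ext m; simp [Fin.le_def]
      rw [this, Fin.card_Ici]
    rw [hsum, Nat.succ_sub h1, Nat.factorial_succ]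
    have e1 : (((n - lam.length) + 1 : ℕ) : F) ≠ 0 := Nat.cast_ne_zero.2 (Nat.succ_ne_zero _)
    have e2 : ((n - lam.length).factorial : F) ≠ 0 := Nat.cast_ne_zero.2 (Nat.factorial_ne_zero _)
    rw [Nat.cast_mul, mul_inv, Nat.succ_eq_add_one, mul_comm (_ : F)⁻¹, mul_assoc,
      inv_mul_cancel_left₀ e1]
  · rw [if_neg h1]
    split_ifs with h2
    · rw [Finset.sum_eq_zero, mul_zero]
      intro w _
      refine summand_eq_zero ha lam _ (w.symm (Fin.last n)) ?_ (by simp [hlast])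
      have := (w.symm (Fin.last n)).isLt
      omega
    · rfl

theorem specializeLast_multiPPoly {a : ℕ → ℂ} (ha : a 1 = 0) (lam : StrictPartition) (n : ℕ) :
    specializeLast n (multiPPoly a lam (n + 1)) = multiPPoly a lam n := by
  have inj := IsFractionRing.injective (MvPolynomial (Fin n) ℂ)
      (FractionRing (MvPolynomial (Fin n) ℂ))
  apply inj
  have hX : ∀ i, ratVar n i ≠ 0 := by
    intro i h
    exact X_ne_zero i (inj (h.trans (map_zero _).symm))
  have hpt : (fun k => algebraMap (MvPolynomial (Fin n) ℂ) (FractionRing (MvPolynomial (Fin n) ℂ))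
      (Fin.snoc (α := fun _ => MvPolynomial (Fin n) ℂ) X 0 k)) =
      Fin.snoc (α := fun _ => FractionRing (MvPolynomial (Fin n) ℂ)) (ratVar n) 0 := by
    funext k
    refine Fin.lastCases ?_ (fun k => ?_) k
    · simp
    · simp [ratVar]
  have hinj : Function.Injective
      (Fin.snoc (α := fun _ => FractionRing (MvPolynomial (Fin n) ℂ)) (ratVar n) 0 :
        Fin (n + 1) → FractionRing (MvPolynomial (Fin n) ℂ)) := by
    refine Fin.snoc_injective_iff.2 ⟨ratVar_injective n, ?_⟩
    rintro ⟨i, hi⟩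
    exact hX i hi
  rw [algebraMap_multiPPoly, multiPRat, ← multiPValue_snoc ha lam _ hX,
    ← aeval_multiPPoly a lam hinj, ← hpt]
  exact (aeval_algebraMap_apply _ _ _).symm

end Membership

/-- The multiparameter Schur P-function `P_{λ;a} ∈ Γ`, for a sequence `a` with `a_1 = 0`. -/
noncomputable def multiP (a : ℕ → ℂ) (ha : a 1 = 0) (lam : StrictPartition) :
    supersymmetricFunctions :=
  ⟨fun n => multiPPoly a lam n, multiPPoly_mem a lam, specializeLast_multiPPoly ha lam,
    _, multiPPoly_totalDegree_le a lam⟩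

/-- The multiparameter Schur Q-function `Q_{λ;a} = 2^{ℓ(λ)} P_{λ;a} ∈ Γ`. -/
noncomputable def multiQ (a : ℕ → ℂ) (ha : a 1 = 0) (lam : StrictPartition) :
    supersymmetricFunctions :=
  (2 : ℂ) ^ lam.length • multiP a ha lam

/-! ### Transition coefficients -/

/-- The complete homogeneous function in the super realization,
`h_k(x_1, …, x_p; y_1, …, y_q) = ∑_{i + j = k} h_i(x) e_j(y)`, that is, the coefficient of `t^k`
in `∏ (1 + y_j t) / ∏ (1 - x_i t)`. -/
noncomputable def superH (k : ℕ) {p q : ℕ} (x : Fin p → ℂ) (y : Fin q → ℂ) : ℂ :=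
  ∑ i ∈ Finset.range (k + 1), aeval x (hsymm (Fin p) ℂ i) * aeval y (esymm (Fin q) ℂ (k - i))

/-- `d_{r r'} = h_{r-r'}(b_2, …, b_{r'+1}; -a_2, …, -a_r)` if `r ≥ r'`, and `0` otherwise. -/
noncomputable def transD (a b : ℕ → ℂ) (r r' : ℕ) : ℂ :=
  if r' ≤ r then
    superH (r - r') (fun i : Fin r' => b (i + 2)) (fun i : Fin (r - 1) => -a (i + 2))
  else 0

/-- `d_{μν} = det (d_{μ_i ν_j})`, where `1 ≤ i, j ≤ ℓ(μ)`. -/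
noncomputable def transCoeff (a b : ℕ → ℂ) (mu nu : StrictPartition) : ℂ :=
  (Matrix.of fun i j : Fin mu.length => transD a b (mu.part i) (nu.part j)).det

end SchurQ

namespace SchurQ

open MvPolynomial

/-! In one variable, the matrix `d` is the change of basis from the powers `(x | a)^r` to the powers
`(x | b)^s`, with `r, s ≥ 1` (`genPow_eq_sum`). This follows by induction on `r`: multiplying `(x |
b)^s` by `x - a_{r+1} = (x - b_{s+1}) + (b_{s+1} - a_{r+1})` produces the recurrence that the super
functions `h_k` satisfy when a variable is adjoined on each side (`transD_succ`). Both bases start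
with `x` because `a_1 = b_1 = 0`.

The symmetrized sum defining `Q` is multilinear in the generalized powers, so it expands over all
exponent sequences `(s_1, …, s_l)` (`symSum_expand`). The factor `∏ (x_i + x_j) / (x_i - x_j)` is
alternating in the first `l` variables, hence the symmetrized sum is alternating in the exponents
(`symSum_comp`): repeated exponents contribute zero (`symSum_eq_zero`), and the rearrangements of a
strict partition `ν` collect into a determinant.

Since `d` is lower triangular, a sequence contributes only if `s_i ≤ μ_i` for all `i`; sorting
preserves this bound (`le_of_strictAnti_comp`), whence `ν ⊂ μ`. The number of parts never changes,
so the powers of `2` agree. -/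

/-! ### Recurrences for super complete homogeneous functions. -/

/-- A multiset of size `k + 1` either avoids `none` or is obtained by adding one copy of `none` to a
multiset of size `k`, which may contain `none` again. -/
theorem aeval_hsymm_option {α : Type*} [Fintype α] [DecidableEq α] (x : Option α → ℂ) (k : ℕ) :
    aeval x (hsymm (Option α) ℂ (k + 1)) =
      aeval (x ∘ some) (hsymm α ℂ (k + 1)) + x none * aeval x (hsymm (Option α) ℂ k) := by
  simp only [hsymm, map_sum, map_multiset_prod, Multiset.map_map, Function.comp_def, aeval_X]
  rw [← (symOptionSuccEquiv (α := α) (n := k)).symm.sum_comp, Fintype.sum_sum_type, add_comm]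
  congr 1
  · refine Finset.sum_congr rfl fun s _ => ?_
    change ((Multiset.map some s.1).map x).prod = _
    rw [Multiset.map_map]
    rfl
  · rw [Finset.mul_sum]
    refine Finset.sum_congr rfl fun s _ => ?_
    change ((none ::ₘ s.1).map x).prod = _
    simp

theorem aeval_hsymm_snoc {p : ℕ} (x : Fin p → ℂ) (u : ℂ) (k : ℕ) :
    aeval (Fin.snoc (α := fun _ => ℂ) x u) (hsymm (Fin (p + 1)) ℂ (k + 1)) =
      aeval x (hsymm (Fin p) ℂ (k + 1)) +
        u * aeval (Fin.snoc (α := fun _ => ℂ) x u) (hsymm (Fin (p + 1)) ℂ k) := by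
  have h : ∀ m, aeval (Fin.snoc (α := fun _ => ℂ) x u) (hsymm (Fin (p + 1)) ℂ m) =
      aeval ((Fin.snoc (α := fun _ => ℂ) x u : Fin (p + 1) → ℂ) ∘ finSuccEquivLast.symm)
        (hsymm (Option (Fin p)) ℂ m) := fun m => by
    rw [← rename_hsymm (Option (Fin p)) ℂ m finSuccEquivLast.symm, aeval_rename]
  rw [h, h, aeval_hsymm_option]
  congr 3
  · funext i
    simp
  · simp

/-- Subsets are split by whether they contain the last index. Unlike for `hsymm`, the new variable
occurs at most once, so both terms on the right involve `y` only. -/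
theorem aeval_esymm_snoc {q : ℕ} (y : Fin q → ℂ) (v : ℂ) (k : ℕ) :
    aeval (Fin.snoc (α := fun _ => ℂ) y v) (esymm (Fin (q + 1)) ℂ (k + 1)) =
      aeval y (esymm (Fin q) ℂ (k + 1)) + v * aeval y (esymm (Fin q) ℂ k) := by
  have h : (Finset.univ : Finset (Fin (q + 1))).val.map (Fin.snoc (α := fun _ => ℂ) y v) =
      v ::ₘ (Finset.univ : Finset (Fin q)).val.map y := by
    rw [Fin.univ_castSuccEmb, Finset.cons_val, Multiset.map_cons, Finset.map_val,
      Multiset.map_map]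
    simp [Function.comp_def]
  rw [aeval_esymm_eq_multiset_esymm, aeval_esymm_eq_multiset_esymm, aeval_esymm_eq_multiset_esymm,
    h]
  simp only [Multiset.esymm, Multiset.powersetCard_cons, Multiset.map_add, Multiset.sum_add,
    Multiset.map_map, Function.comp_def, Multiset.prod_cons, Multiset.sum_map_mul_left]

theorem superH_zero {p q : ℕ} (x : Fin p → ℂ) (y : Fin q → ℂ) : superH 0 x y = 1 := by
  simp [superH]

/-- In terms of generating functions, adjoining `u` divides the series by `1 - u t`. -/
theorem superH_snoc_left {p q : ℕ} (x : Fin p → ℂ) (u : ℂ) (y : Fin q → ℂ) (k : ℕ) :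
    superH (k + 1) (Fin.snoc (α := fun _ => ℂ) x u) y =
      superH (k + 1) x y + u * superH k (Fin.snoc (α := fun _ => ℂ) x u) y := by
  simp only [superH]
  rw [Finset.sum_range_succ', Finset.sum_range_succ' _ (k + 1)]
  simp only [aeval_hsymm_snoc, Nat.add_sub_add_right, add_mul, Finset.sum_add_distrib, hsymm_zero,
    Finset.mul_sum, mul_assoc, map_one]
  ring

/-- In terms of generating functions, adjoining `v` multiplies the series by `1 + v t`. -/
theorem superH_snoc_right {p q : ℕ} (x : Fin p → ℂ) (y : Fin q → ℂ) (v : ℂ) (k : ℕ) :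
    superH (k + 1) x (Fin.snoc (α := fun _ => ℂ) y v) =
      superH (k + 1) x y + v * superH k x y := by
  simp only [superH]
  -- The term `i = k + 1` carries `e_0`, to which the recurrence for `e` does not apply; it is the
  -- same on both sides.
  rw [Finset.sum_range_succ, Finset.sum_range_succ _ (k + 1), Finset.mul_sum, add_right_comm,
    ← Finset.sum_add_distrib]
  congr 1
  · refine Finset.sum_congr rfl fun i hi => ?_
    rw [Nat.succ_sub (Finset.mem_range_succ_iff.1 hi), Nat.succ_eq_add_one, aeval_esymm_snoc]
    ring
  · simp

/-- Without variables on the left only `e_k(y)` remains, and it vanishes for fewer than `k`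
variables. -/
theorem superH_eq_zero {q k : ℕ} (x : Fin 0 → ℂ) (y : Fin q → ℂ) (h : q < k) :
    superH k x y = 0 := by
  refine Finset.sum_eq_zero fun i _ => ?_
  rcases i with _ | i
  · rw [esymm, Finset.powersetCard_eq_empty.2 (by simpa using h)]
    simp
  · simp [hsymm]

/-! ### Recurrence for the coefficients `d`. -/

theorem transD_of_lt (a b : ℕ → ℂ) {r s : ℕ} (h : r < s) : transD a b r s = 0 :=
  if_neg (not_le.2 h)

theorem transD_self (a b : ℕ → ℂ) (r : ℕ) : transD a b r r = 1 := by
  rw [transD, if_pos le_rfl, Nat.sub_self, superH_zero]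

/-- The coefficient is `e_{r+1}` of the `r` numbers `-a_2, …, -a_{r+1}`. Its vanishing keeps `(x |
b)^0` out of the expansion. -/
theorem transD_zero (a b : ℕ → ℂ) (r : ℕ) : transD a b (r + 1) 0 = 0 := by
  rw [transD, if_pos (Nat.zero_le _)]
  exact superH_eq_zero _ _ (by simp)

/-- For `s ≤ r`, splitting off the last right variable `-a_{r+2}` and then the last left variable
`b_{s+2}` leaves exactly the two coefficients of row `r + 1`. On and above the diagonal the values
`0` and `1` are compared directly. -/
theorem transD_succ (a b : ℕ → ℂ) (r s : ℕ) :
    transD a b (r + 2) (s + 1) =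
      transD a b (r + 1) s + (b (s + 2) - a (r + 2)) * transD a b (r + 1) (s + 1) := by
  rcases lt_trichotomy s (r + 1) with h | rfl | h
  · have hsnoc : ∀ (c : ℕ → ℂ) (m : ℕ), (fun i : Fin (m + 1) => c i) =
        Fin.snoc (α := fun _ => ℂ) (fun i : Fin m => c i) (c m) := fun c m => by
      funext i
      refine Fin.lastCases ?_ (fun i => ?_) i <;> simp
    have ea := hsnoc (fun i => -a (i + 2)) r
    have eb := hsnoc (fun i => b (i + 2)) s
    obtain ⟨k, rfl⟩ := Nat.exists_eq_add_of_le (Nat.lt_succ_iff.1 h)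
    have h1 : s + k + 2 - (s + 1) = k + 1 := by omega
    have h2 : s + k + 1 - s = k + 1 := by omega
    have h3 : s + k + 1 - (s + 1) = k := by omega
    rw [transD, transD, transD, if_pos (by omega), if_pos (by omega), if_pos (by omega), h1, h2, h3]
    change superH (k + 1) _ (fun i : Fin (s + k + 1) => -a (i + 2)) =
      superH (k + 1) _ (fun i : Fin (s + k) => -a (i + 2)) +
        _ * superH k _ (fun i : Fin (s + k) => -a (i + 2))
    rw [ea, superH_snoc_right, eb, superH_snoc_left]
    ring
  · rw [transD_self, transD_self, transD_of_lt a b (Nat.lt_succ_self _)]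
    ring
  · rw [transD_of_lt a b (by omega), transD_of_lt a b h, transD_of_lt a b (by omega)]
    ring

/-! ### Change of basis between generalized powers in one variable. -/

section Field

variable {F : Type*} [Field F] [Algebra ℂ F]

theorem genPow_succ (a : ℕ → ℂ) (x : F) (m : ℕ) :
    genPow a x (m + 1) = genPow a x m * (x - algebraMap ℂ F (a (m + 1))) :=
  Finset.prod_Icc_succ_top (Nat.le_add_left 1 m) _

theorem genPow_eq_sum_range {a b : ℕ → ℂ} (ha : a 1 = 0) (hb : b 1 = 0) (x : F) (r : ℕ) :
    genPow a x (r + 1) =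
      ∑ s ∈ Finset.range (r + 1), algebraMap ℂ F (transD a b (r + 1) (s + 1)) *
        genPow b x (s + 1) := by
  induction r with
  | zero => simp [transD_self, genPow, ha, hb]
  | succ r ih =>
    have hstep : ∀ s, algebraMap ℂ F (transD a b (r + 2) (s + 1)) * genPow b x (s + 1) =
        algebraMap ℂ F (transD a b (r + 1) s) * genPow b x (s + 1) +
        algebraMap ℂ F (transD a b (r + 1) (s + 1)) * ((algebraMap ℂ F (b (s + 2)) -
          algebraMap ℂ F (a (r + 2))) * genPow b x (s + 1)) := fun s => by
      rw [transD_succ, map_add, map_mul, map_sub]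
      ring
    -- The boundary terms drop out: `d_{r+1,0} = 0` in the first sum, which allows an index shift,
    -- and `d_{r+1,r+2} = 0` in the second. What remains agrees termwise, since `x - a_{r+2} = (x -
    -- b_{s+2}) + (b_{s+2} - a_{r+2})`.
    rw [genPow_succ, ih, Finset.sum_congr rfl fun s _ => hstep s, Finset.sum_add_distrib,
      Finset.sum_range_succ' _ (r + 1), Finset.sum_range_succ _ (r + 1), transD_zero,
      transD_of_lt a b (Nat.lt_succ_self (r + 1)), map_zero, zero_mul, zero_mul, add_zero, add_zero,
      ← Finset.sum_add_distrib, Finset.sum_mul]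
    refine Finset.sum_congr rfl fun s _ => ?_
    rw [genPow_succ b x (s + 1)]
    ring

/-- The upper limit `N` is independent of `r`, so that a product of such expansions runs over a cube
of exponent sequences. -/
theorem genPow_eq_sum {a b : ℕ → ℂ} (ha : a 1 = 0) (hb : b 1 = 0) (x : F) {r N : ℕ} (hr : 0 < r)
    (hN : r ≤ N) :
    genPow a x r =
      ∑ s ∈ Finset.Icc 1 N, algebraMap ℂ F (transD a b r s) * genPow b x s := by
  obtain ⟨r, rfl⟩ := Nat.exists_eq_add_of_lt hr
  rw [zero_add] at hN ⊢
  rw [genPow_eq_sum_range ha hb, Finset.range_eq_Ico, Finset.sum_Ico_add'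
    (fun s => algebraMap ℂ F (transD a b (r + 1) s) * genPow b x s)]
  refine Finset.sum_subset (fun s hs => ?_) fun s hs hs' => ?_
  · simp only [Finset.mem_Ico, Finset.mem_Icc] at hs ⊢
    omega
  · simp only [Finset.mem_Ico, Finset.mem_Icc] at hs hs'
    rw [transD_of_lt a b (by omega), map_zero, zero_mul]

end Field
-- Symmetrized sums for arbitrary exponent sequences.
section Alternating

variable {F : Type*} [Field F] [Algebra ℂ F] {l m : ℕ}

/-- The product of `(x_i + x_j) / (x_i - x_j)` over `i ≤ l` and `i < j ≤ l + m`. -/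
def pairFactor (x : Fin (l + m) → F) : F :=
  (∏ i : Fin l, ∏ j ∈ Finset.Ioi i, (x (Fin.castAdd m i) + x (Fin.castAdd m j)) /
    (x (Fin.castAdd m i) - x (Fin.castAdd m j))) *
  ∏ i : Fin l, ∏ j : Fin m, (x (Fin.castAdd m i) + x (Fin.natAdd l j)) /
    (x (Fin.castAdd m i) - x (Fin.natAdd l j))

/-- The symmetrization of the summand of the multiparameter P-function, for an arbitrary sequence
`r` of exponents in place of the parts of a strict partition. -/
def symSum (a : ℕ → ℂ) (x : Fin (l + m) → F) (r : Fin l → ℕ) : F :=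
  ∑ w : Equiv.Perm (Fin (l + m)),
    (∏ i : Fin l, genPow a (x (w (Fin.castAdd m i))) (r i)) * pairFactor (x ∘ w)

theorem summand_eq_mul_pairFactor (a : ℕ → ℂ) (lam : StrictPartition) (hl : lam.length = l)
    (x : Fin (l + m) → F) :
    summand a lam x =
      (∏ i : Fin l, genPow a (x (Fin.castAdd m i)) (lam.part i)) * pairFactor x := by
  unfold summand pairFactor
  simp only [Finset.prod_filter, hl, Fin.prod_univ_add (a := l) (b := m)]
  simp only [Fin.val_castAdd, Fin.is_lt, if_true, Fin.val_natAdd, Fin.lt_def,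
    Nat.not_lt.2 (Nat.le_add_right l _), if_false, Finset.prod_const_one, mul_one]
  congr 1
  rw [← Finset.prod_mul_distrib]
  refine Finset.prod_congr rfl fun i _ => ?_
  congr 1
  · rw [← Finset.prod_filter]
    refine Finset.prod_congr ?_ fun _ _ => rfl
    ext j
    simp only [Finset.mem_filter, Finset.mem_univ, Finset.mem_Ioi, true_and]
    exact Fin.lt_def.symm
  · refine Finset.prod_congr rfl fun j _ => if_pos ?_
    omega

/-- The prefactor depends only on `m = n - l`, so it is common to all partitions of the same length.
-/
theorem multiPValue_eq_symSum (a : ℕ → ℂ) (lam : StrictPartition) (hl : lam.length = l)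
    (x : Fin (l + m) → F) :
    multiPValue a lam x = (m.factorial : F)⁻¹ * symSum a x fun i => lam.part i := by
  rw [multiPValue, if_pos (by omega), hl, Nat.add_sub_cancel_left, symSum]
  congr 1
  exact Finset.sum_congr rfl fun w _ => summand_eq_mul_pairFactor a lam hl _

/-- The permutation of `l + m` letters acting on the first `l` letters by `s`. -/
def permCastAdd (m : ℕ) (s : Equiv.Perm (Fin l)) : Equiv.Perm (Fin (l + m)) :=
  finSumFinEquiv.permCongr (Equiv.sumCongr s (Equiv.refl (Fin m)))

theorem permCastAdd_castAdd (s : Equiv.Perm (Fin l)) (i : Fin l) :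
    permCastAdd m s (Fin.castAdd m i) = Fin.castAdd m (s i) := by
  simp [permCastAdd, Equiv.permCongr_apply]

theorem permCastAdd_natAdd (s : Equiv.Perm (Fin l)) (j : Fin m) :
    permCastAdd m s (Fin.natAdd l j) = Fin.natAdd l j := by
  simp [permCastAdd, Equiv.permCongr_apply]

/-- Among the first `l` variables each factor changes sign when its two variables are exchanged; the
factors mixing the two groups are only permuted. -/
theorem pairFactor_comp {K : Type*} [Field K] (x : Fin (l + m) → K) (s : Equiv.Perm (Fin l)) :
    pairFactor (x ∘ permCastAdd m s) = ((Equiv.Perm.sign s : ℤ) : K) * pairFactor x := by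
  unfold pairFactor
  simp only [Function.comp_apply, permCastAdd_castAdd, permCastAdd_natAdd]
  rw [s.prod_Ioi_comp_eq_sign_mul_prod (f := fun i j =>
    (x (Fin.castAdd m i) + x (Fin.castAdd m j)) / (x (Fin.castAdd m i) - x (Fin.castAdd m j))),
    s.prod_comp Finset.univ (fun i => ∏ j : Fin m, (x (Fin.castAdd m i) + x (Fin.natAdd l j)) /
      (x (Fin.castAdd m i) - x (Fin.natAdd l j))) (by simp), mul_assoc]
  intro i j
  rw [← div_neg, neg_sub, add_comm]

/-- Permuting the exponents amounts to permuting the first `l` variables before symmetrizing, and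
`pairFactor` then contributes the sign. -/
theorem symSum_comp (a : ℕ → ℂ) (x : Fin (l + m) → F) (r : Fin l → ℕ) (s : Equiv.Perm (Fin l)) :
    symSum a x (r ∘ s) = ((Equiv.Perm.sign s : ℤ) : F) * symSum a x r := by
  unfold symSum
  rw [Finset.mul_sum]
  refine Fintype.sum_equiv (Equiv.mulRight (permCastAdd m s⁻¹)) _ _ fun w => ?_
  rw [Equiv.coe_mulRight, Equiv.Perm.coe_mul, ← Function.comp_assoc, pairFactor_comp,
    Equiv.Perm.sign_inv]
  have h1 : ((Equiv.Perm.sign s : ℤ) : F) * ((Equiv.Perm.sign s : ℤ) : F) = 1 := by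
    rw [← Int.cast_mul, ← Units.val_mul, Int.units_mul_self]; simp
  have h2 : ∏ i : Fin l, genPow a (x (w (Fin.castAdd m i))) ((r ∘ s) i) =
      ∏ i : Fin l, genPow a (x ((⇑w ∘ permCastAdd m s⁻¹) (Fin.castAdd m i))) (r i) :=
    Fintype.prod_equiv s _ _ fun i => by simp [permCastAdd_castAdd]
  rw [h2]
  linear_combination -(∏ i : Fin l, genPow a (x ((⇑w ∘ permCastAdd m s⁻¹) (Fin.castAdd m i)))
    (r i)) * pairFactor (x ∘ w) * h1

/-- Exchanging two equal exponents shows that the sum is its own negative, in characteristic zero.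
-/
theorem symSum_eq_zero (a : ℕ → ℂ) (x : Fin (l + m) → F) {r : Fin l → ℕ}
    (hr : ¬ Function.Injective r) : symSum a x r = 0 := by
  have hchar : CharZero F := charZero_of_injective_algebraMap (algebraMap ℂ F).injective
  simp only [Function.Injective, not_forall] at hr
  obtain ⟨i, j, hij, hne⟩ := hr
  have hswap : r ∘ Equiv.swap i j = r := by
    funext k
    simp only [Function.comp_apply, Equiv.swap_apply_def]
    split_ifs <;> simp_all
  have h := symSum_comp a x r (Equiv.swap i j)
  rw [hswap, Equiv.Perm.sign_swap hne] at h
  simp only [Units.val_neg, Units.val_one, Int.cast_neg, Int.cast_one, neg_mul, one_mul] at h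
  exact self_eq_neg.1 h

theorem symSum_expand {a b : ℕ → ℂ} (ha : a 1 = 0) (hb : b 1 = 0) (x : Fin (l + m) → F)
    {r : Fin l → ℕ} {N : ℕ} (hr : ∀ i, 0 < r i) (hN : ∀ i, r i ≤ N) :
    symSum a x r = ∑ s ∈ Fintype.piFinset fun _ : Fin l => Finset.Icc 1 N,
      algebraMap ℂ F (∏ i, transD a b (r i) (s i)) * symSum b x s := by
  unfold symSum
  simp only [Finset.mul_sum]
  rw [Finset.sum_comm]
  refine Finset.sum_congr rfl fun w _ => ?_
  rw [Finset.prod_congr rfl fun i _ => genPow_eq_sum ha hb _ (hr i) (hN i), Finset.prod_univ_sum,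
    Finset.sum_mul]
  refine Finset.sum_congr rfl fun s _ => ?_
  rw [Finset.prod_mul_distrib, map_prod, mul_assoc]

end Alternating

/-! ### Strict partitions as sorted exponent sequences. -/

namespace StrictPartition

theorem part_strictAnti (lam : StrictPartition) :
    StrictAnti fun i : Fin lam.length => lam.part i := by
  intro i j hij
  change lam.parts.getD j 0 < lam.parts.getD i 0
  rw [List.getD_eq_getElem _ _ i.2, List.getD_eq_getElem _ _ j.2]
  exact List.pairwise_iff_getElem.1 lam.decreasing i j i.2 j.2 hij

theorem ext_part {lam nu : StrictPartition} (hl : lam.length = nu.length)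
    (h : ∀ i < lam.length, lam.part i = nu.part i) : lam = nu := by
  ext1
  refine List.ext_getElem hl fun i h1 h2 => ?_
  have := h i h1
  simp only [part] at this
  rwa [List.getD_eq_getElem _ _ h1, List.getD_eq_getElem _ _ h2] at this

theorem part_of_length_le (lam : StrictPartition) {i : ℕ} (h : lam.length ≤ i) : lam.part i = 0 :=
  List.getD_eq_default _ _ h

/-- The strict partition with the given decreasing sequence of parts. -/
def ofStrictAnti {l : ℕ} (r : Fin l → ℕ) (hr : StrictAnti r) (hpos : ∀ i, 0 < r i) :
    StrictPartition where
  parts := List.ofFn r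
  decreasing := List.pairwise_ofFn.2 fun _ _ h => hr h
  positive := by
    intro p hp
    obtain ⟨i, rfl⟩ := List.mem_ofFn.1 hp
    exact hpos i

theorem length_ofStrictAnti {l : ℕ} (r : Fin l → ℕ) (hr : StrictAnti r) (hpos : ∀ i, 0 < r i) :
    (ofStrictAnti r hr hpos).length = l :=
  List.length_ofFn

theorem part_ofStrictAnti {l : ℕ} (r : Fin l → ℕ) (hr : StrictAnti r) (hpos : ∀ i, 0 < r i)
    (i : Fin l) : (ofStrictAnti r hr hpos).part i = r i := by
  simp [ofStrictAnti, part]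

theorem mem_containedSameLength {mu nu : StrictPartition} :
    nu ∈ mu.containedSameLength ↔ nu.length = mu.length ∧ nu.Contained mu := by
  simp [containedSameLength]

end StrictPartition

/-- A sequence of distinct numbers bounded by a decreasing one is still bounded by it after
being sorted. -/
theorem le_of_strictAnti_comp {l : ℕ} {r p : Fin l → ℕ} (hr : StrictAnti r) (hp : StrictAnti p)
    (s : Equiv.Perm (Fin l)) (h : ∀ i, r (s i) ≤ p i) (k : Fin l) : r k ≤ p k := by
  -- Pigeonhole: `s` cannot map the indices `≥ k` injectively into the indices `> k`, of which there
  -- is one fewer. Such an `i` gives `r k ≤ r (s i) ≤ p i ≤ p k`.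
  obtain ⟨i, hik, hsk⟩ : ∃ i, k ≤ i ∧ s i ≤ k := by
    by_contra! hcon
    have hsub : (Finset.Ici k).map s.toEmbedding ⊆ Finset.Ioi k := by
      intro j hj
      obtain ⟨i, hi, rfl⟩ := Finset.mem_map.1 hj
      exact Finset.mem_Ioi.2 (hcon i (Finset.mem_Ici.1 hi))
    have := Finset.card_le_card hsub
    rw [Finset.card_map, Fin.card_Ici, Fin.card_Ioi] at this
    omega
  exact (hr.antitone hsk).trans ((h i).trans (hp.antitone hik))

theorem exists_strictAnti_comp_perm {l : ℕ} {r : Fin l → ℕ} (hr : Function.Injective r) :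
    ∃ s : Equiv.Perm (Fin l), StrictAnti (r ∘ s) := by
  refine ⟨Fin.revPerm.trans (Tuple.sort r), ?_⟩
  have h : StrictMono (r ∘ Tuple.sort r) :=
    (Tuple.monotone_sort r).strictMono_of_injective (hr.comp (Tuple.sort r).injective)
  exact fun i j hij => h (Fin.rev_lt_rev.2 hij)

/-- A decreasing sequence is determined by its set of values, and its injectivity then recovers the
permutation. This makes the pairs `(ν, s)` distinct as exponent sequences. -/
theorem strictAnti_comp_perm_unique {l : ℕ} {r p : Fin l → ℕ} (hr : StrictAnti r)
    (hp : StrictAnti p) {s t : Equiv.Perm (Fin l)} (h : r ∘ s = p ∘ t) : r = p ∧ s = t := by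
  have hrp : r = p := by
    have hrange : Set.range r = Set.range p := by
      rw [← s.surjective.range_comp r, h, t.surjective.range_comp p]
    have h1 : StrictMono (r ∘ Fin.rev) := fun i j hij => hr (Fin.rev_lt_rev.2 hij)
    have h2 : StrictMono (p ∘ Fin.rev) := fun i j hij => hp (Fin.rev_lt_rev.2 hij)
    have h3 := (StrictMono.range_inj h1 h2).1 (by
      rw [Fin.rev_surjective.range_comp, Fin.rev_surjective.range_comp, hrange])
    funext i
    simpa using congrFun h3 i.rev
  subst hrp
  exact ⟨rfl, Equiv.ext fun i => hr.injective (congrFun h i)⟩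

/-! ### Collecting the expansion into determinants. -/

section Field

variable {F : Type*} [Field F] [Algebra ℂ F] {n : ℕ}

theorem multiPValue_eq_sum {a b : ℕ → ℂ} (ha : a 1 = 0) (hb : b 1 = 0) (mu : StrictPartition)
    (x : Fin n → F) :
    multiPValue a mu x =
      ∑ nu ∈ mu.containedSameLength, algebraMap ℂ F (transCoeff a b mu nu) *
        multiPValue b nu x := by
  rcases Nat.lt_or_ge n mu.length with hn | hn
  · rw [multiPValue, if_neg (not_le.2 hn), Finset.sum_eq_zero]
    intro nu hnu
    rw [multiPValue, if_neg, mul_zero]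
    rw [(StrictPartition.mem_containedSameLength.1 hnu).1]
    exact not_le.2 hn
  obtain ⟨m, rfl⟩ := Nat.exists_eq_add_of_le hn
  have hmu : StrictAnti fun i : Fin mu.length => mu.part i := mu.part_strictAnti
  have hanti : ∀ nu ∈ mu.containedSameLength, StrictAnti fun i : Fin mu.length => nu.part i := by
    intro nu hnu
    rw [← (StrictPartition.mem_containedSameLength.1 hnu).1]
    exact nu.part_strictAnti
  have hterm : ∀ nu ∈ mu.containedSameLength,
      algebraMap ℂ F (transCoeff a b mu nu) * multiPValue b nu x =
        (m.factorial : F)⁻¹ * ∑ s : Equiv.Perm (Fin mu.length),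
          algebraMap ℂ F (∏ i : Fin mu.length, transD a b (mu.part i) (nu.part (s i))) *
            symSum b x ((fun i : Fin mu.length => nu.part i) ∘ s) := by
    intro nu hnu
    -- Transposing makes the permutation in the Leibniz formula act on the parts of `ν`; its sign is
    -- then absorbed by `symSum_comp`.
    rw [multiPValue_eq_symSum b nu (StrictPartition.mem_containedSameLength.1 hnu).1, transCoeff,
      ← Matrix.det_transpose, Matrix.det_apply', map_sum, Finset.sum_mul, Finset.mul_sum]
    refine Finset.sum_congr rfl fun s _ => ?_
    rw [symSum_comp, map_mul, map_intCast]
    simp only [Matrix.transpose_apply, Matrix.of_apply]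
    ring
  rw [Finset.sum_congr rfl hterm, ← Finset.mul_sum, multiPValue_eq_symSum a mu rfl,
    symSum_expand (N := mu.part 0) ha hb x (fun i => mu.part_pos i.2)
      (fun i => hmu.antitone (a := ⟨0, i.pos⟩) (Nat.zero_le i)), ← Finset.sum_product']
  congr 1
  symm
  -- The pairs `(ν, s)` embed into the cube of exponent sequences as rearrangements of `ν`. A
  -- sequence outside the image has a repeated entry or exceeds `μ` somewhere, so its term vanishes.
  refine Finset.sum_of_injOn (fun q i => q.1.part (q.2 i)) ?_ ?_ ?_ fun q _ => rfl
  · rintro ⟨nu, s⟩ hnu ⟨rho, t⟩ hrho h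
    have hnu := (Finset.mem_product.1 (Finset.mem_coe.1 hnu)).1
    have hrho := (Finset.mem_product.1 (Finset.mem_coe.1 hrho)).1
    obtain ⟨h1, rfl⟩ := strictAnti_comp_perm_unique (hanti nu hnu) (hanti rho hrho) h
    have hnu' := (StrictPartition.mem_containedSameLength.1 hnu).1
    have hrho' := (StrictPartition.mem_containedSameLength.1 hrho).1
    have : nu = rho := StrictPartition.ext_part (hnu'.trans hrho'.symm)
      fun i hi => congrFun h1 ⟨i, hi.trans_eq hnu'⟩
    rw [this]
  · rintro ⟨nu, s⟩ hnu
    have hnu := (Finset.mem_product.1 (Finset.mem_coe.1 hnu)).1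
    obtain ⟨hlen, hcon⟩ := StrictPartition.mem_containedSameLength.1 hnu
    simp only [Finset.mem_coe, Fintype.mem_piFinset, Finset.mem_Icc]
    refine fun i => ⟨nu.part_pos (by rw [hlen]; exact (s i).2), (hcon _).trans ?_⟩
    exact hmu.antitone (a := ⟨0, i.pos⟩) (Nat.zero_le (s i : ℕ))
  · intro r hr hr'
    simp only [Fintype.mem_piFinset, Finset.mem_Icc] at hr
    by_cases hinj : Function.Injective r
    · rw [mul_eq_zero]
      left
      suffices ∃ i : Fin mu.length, mu.part i < r i by
        obtain ⟨i, hi⟩ := this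
        rw [Finset.prod_eq_zero (Finset.mem_univ i) (transD_of_lt a b hi), map_zero]
      by_contra! hle
      obtain ⟨s, hs⟩ := exists_strictAnti_comp_perm hinj
      refine hr' ⟨(StrictPartition.ofStrictAnti (r ∘ s) hs fun i => (hr _).1, s⁻¹), ?_, ?_⟩
      · simp only [Finset.mem_coe, Finset.mem_product, Finset.mem_univ, and_true]
        refine StrictPartition.mem_containedSameLength.2
          ⟨StrictPartition.length_ofStrictAnti _ _ _, fun i => ?_⟩
        rcases Nat.lt_or_ge i mu.length with hi | hi
        · rw [StrictPartition.part_ofStrictAnti _ _ _ ⟨i, hi⟩]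
          exact le_of_strictAnti_comp hs hmu s⁻¹ (fun i => by simpa using hle i) ⟨i, hi⟩
        · rw [StrictPartition.part_of_length_le]
          · exact Nat.zero_le _
          · rwa [StrictPartition.length_ofStrictAnti]
      · funext i
        simp [StrictPartition.part_ofStrictAnti]
    · rw [symSum_eq_zero b x hinj, mul_zero]

end Field

/-! ### The identity in `Γ`, checked at the generic point for each `n`. -/

theorem multiP_eq_sum {a b : ℕ → ℂ} (ha : a 1 = 0) (hb : b 1 = 0) (mu : StrictPartition) :
    multiP a ha mu = ∑ nu ∈ mu.containedSameLength, transCoeff a b mu nu • multiP b hb nu := by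
  apply Subtype.ext
  funext n
  apply IsFractionRing.injective (MvPolynomial (Fin n) ℂ) (FractionRing (MvPolynomial (Fin n) ℂ))
  simp only [AddSubmonoidClass.coe_finsetSum, Subalgebra.coe_smul, Finset.sum_apply, Pi.smul_apply,
    map_sum, multiP]
  rw [algebraMap_multiPPoly, multiPRat, multiPValue_eq_sum ha hb]
  refine Finset.sum_congr rfl fun nu _ => ?_
  rw [Algebra.smul_def, map_mul, algebraMap_multiPPoly, multiPRat,
    ← IsScalarTower.algebraMap_apply]

end SchurQ

theorem mainTheorem4 (a b : ℕ → ℂ) (ha : a 1 = 0) (hb : b 1 = 0) (mu : SchurQ.StrictPartition) :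
    SchurQ.multiQ a ha mu =
      ∑ nu ∈ mu.containedSameLength, SchurQ.transCoeff a b mu nu • SchurQ.multiQ b hb nu := by
  rw [SchurQ.multiQ, SchurQ.multiP_eq_sum ha hb, Finset.smul_sum]
  refine Finset.sum_congr rfl fun nu hnu => ?_
  -- Equal lengths turn the factor `2 ^ ℓ(ν)` into `2 ^ ℓ(μ)`.
  rw [SchurQ.multiQ, (SchurQ.StrictPartition.mem_containedSameLength.1 hnu).1, smul_comm]
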